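/- Let $A\in\mathbb{C}^{n\times n}$ and write $A=D-E-F$ with $D$ the diagonal of $A$ and $-E$, $-F$ its strictly lower and strictly upper triangular parts. Call $A$ *2-cyclic* if some simultaneous permutation of rows and columns brings it to the form $\begin{bmatrix}D_1&A_{12}\\A_{21}&D_2\end{bmatrix}$ with $D_1,D_2$ diagonal and nonsingular, and *consistently ordered* if the eigenvalues (with multiplicities) of $\alpha D^{-1}E+\alpha^{-1}D^{-1}F$ do not depend on $\alpha\in\mathbb{C}\setminus\{0\}$. Put $\mathcal{J}=D^{-1}(E+F)$ and, for $\omega\in\mathbb{C}$, $\mathcal{L}_\omega=(D-\omega E)^{-1}(\omega F+(1-\omega)D)$. For a matrix $B$ let $\sigma(B)$ be its spectrum, $\rho(B)$ its spectral radius and $R_\infty(B)=-\log\rho(B)$. Let $S=\{z\in\mathbb{C}:\operatorname{Re}z\ge 0\}\setminus[1,\infty)$. Consider complex matrices $A$ (of any size) that are 2-cyclic and consistently ordered, together with $\tilde\mu\in S$ such that $\sigma(\mathcal{J})\subseteq[-\tilde\mu,\tilde\mu]=\{t\tilde\mu:t\in[-1,1]\}$ and $\pm\tilde\mu\in\sigma(\mathcal{J})$.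 Put $\delta=|\operatorname{Arg}(\tilde\mu-1)|$ with $\operatorname{Arg}\in(-\pi,\pi]$, and $$\omega_{\rm opt}=\frac{2}{1+\sqrt{1-\tilde\mu^2}}$$ with the principal square root. Then $\omega_{\rm opt}$ is an optimal relaxation parameter, i.e. $\rho(\mathcal{L}_{\omega_{\rm opt}})\le\rho(\mathcal{L}_\omega)$ for all $\omega\in\mathbb{C}$, and $$R_\infty(\mathcal{L}_{\omega_{\rm opt}})=-\log\rho(\mathcal{L}_{\omega_{\rm opt}})\sim 2\sqrt2\,\sin\left(\tfrac{\delta}{2}\right)\sqrt{|1-\tilde\mu|}\qquad\text{as }\tilde\mu\to1,\ \tilde\mu\in S.$$ Here $\sim$ means that the quotient of the two sides tends to $1$, along every family (indexed by any set with a filter) of such pairs $(A,\tilde\mu)$ with $\tilde\mu\to1$; thus the limit is uniform over all such matrices $A$ of all sizes. If moreover $\tilde\mu$ is real for every member of the family, then also $$R_\infty(\mathcal{L}_{\omega_{\rm opt}})\sim 2\sqrt2\,\left[R_\infty(\mathcal{J})\right]^{1/2}.$$ -/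

import Mathlib

open Filter Topology

noncomputable section

namespace SOR

variable {n : ℕ}

/-- The diagonal part `D` of the splitting `A = D - E - F`. -/
def diagPart (A : Matrix (Fin n) (Fin n) ℂ) : Matrix (Fin n) (Fin n) ℂ :=
  Matrix.diagonal A.diag

/-- The negated strictly lower triangular part `E` of the splitting `A = D - E - F`. -/
def lowerPart (A : Matrix (Fin n) (Fin n) ℂ) : Matrix (Fin n) (Fin n) ℂ :=
  Matrix.of fun i j => if j < i then -A i j else 0

/-- The negated strictly upper triangular part `F` of the splitting `A = D - E - F`. -/
def upperPart (A : Matrix (Fin n) (Fin n) ℂ) : Matrix (Fin n) (Fin n) ℂ :=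
  Matrix.of fun i j => if i < j then -A i j else 0

theorem splitting (A : Matrix (Fin n) (Fin n) ℂ) :
    A = diagPart A - lowerPart A - upperPart A := by
  ext i j
  rcases lt_trichotomy i j with h | h | h
  · simp [diagPart, lowerPart, upperPart, h, h.ne, h.not_gt]
  · subst h
    simp [diagPart, lowerPart, upperPart]
  · simp [diagPart, lowerPart, upperPart, h, h.ne', h.not_gt]

/-- The Jacobi iteration matrix `D⁻¹ (E + F)`. -/
def jacobiMatrix (A : Matrix (Fin n) (Fin n) ℂ) : Matrix (Fin n) (Fin n) ℂ :=
  (diagPart A)⁻¹ * (lowerPart A + upperPart A)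

/-- The SOR iteration matrix `(D - ω E)⁻¹ (ω F + (1 - ω) D)`. -/
def sorMatrix (A : Matrix (Fin n) (Fin n) ℂ) (ω : ℂ) : Matrix (Fin n) (Fin n) ℂ :=
  (diagPart A - ω • lowerPart A)⁻¹ * (ω • upperPart A + (1 - ω) • diagPart A)

/-- The spectral radius: the largest modulus of an eigenvalue. -/
def rho (B : Matrix (Fin n) (Fin n) ℂ) : ℝ :=
  (spectralRadius ℂ B).toReal

/-- The asymptotic convergence rate of the iteration with iteration matrix `B`. -/
def asymptoticRate (B : Matrix (Fin n) (Fin n) ℂ) : ℝ :=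
  -Real.log (rho B)

/-- `A` is 2-cyclic: a simultaneous permutation of its rows and columns brings it into the
block form `[D₁, A₁₂; A₂₁, D₂]` with `D₁`, `D₂` diagonal and nonsingular. -/
def IsTwoCyclic (A : Matrix (Fin n) (Fin n) ℂ) : Prop :=
  ∃ (p q : ℕ) (e : Fin n ≃ Fin p ⊕ Fin q) (d₁ : Fin p → ℂ) (d₂ : Fin q → ℂ)
    (A₁₂ : Matrix (Fin p) (Fin q) ℂ) (A₂₁ : Matrix (Fin q) (Fin p) ℂ),
    (∀ i, d₁ i ≠ 0) ∧ (∀ j, d₂ j ≠ 0) ∧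
    Matrix.reindex e e A =
      Matrix.fromBlocks (Matrix.diagonal d₁) A₁₂ A₂₁ (Matrix.diagonal d₂)

/-- `A` is consistently ordered (in the 2-cyclic case): the eigenvalues, with multiplicities, of
`α D⁻¹ E + α⁻¹ D⁻¹ F` do not depend on `α ≠ 0`. -/
def IsConsistentlyOrdered (A : Matrix (Fin n) (Fin n) ℂ) : Prop :=
  ∀ α : ℂ, α ≠ 0 →
    (α • ((diagPart A)⁻¹ * lowerPart A) + α⁻¹ • ((diagPart A)⁻¹ * upperPart A)).charpoly =
      (jacobiMatrix A).charpoly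

/-- The relaxation parameter `2 / (1 + √(1 - μ²))`, with the principal square root. -/
def omegaOpt (μ : ℂ) : ℂ :=
  2 / (1 + (1 - μ ^ 2) ^ (1 / 2 : ℂ))

/-- `ω` is an optimal relaxation parameter for `A`: among all complex relaxation parameters it
minimizes the spectral radius of the SOR iteration matrix. -/
def IsOptimalRelaxation (A : Matrix (Fin n) (Fin n) ℂ) (ω : ℂ) : Prop :=
  ∀ ω' : ℂ, rho (sorMatrix A ω) ≤ rho (sorMatrix A ω')

/-- The closed right half-plane minus the slit `[1, ∞)`. -/
def slitHalfPlane : Set ℂ :=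
  {z | 0 ≤ z.re} \ {z | 1 ≤ z.re ∧ z.im = 0}

/-- `δ = |Arg (μ - 1)|`, with the principal argument in `(-π, π]`. -/
def phase (μ : ℂ) : ℝ :=
  |Complex.arg (μ - 1)|

end SOR

end

/-! Young's relation `ξ² + ω - 1 = ωξν` ties eigenvalues `ξ²` of the SOR matrix to eigenvalues `ν`
of the Jacobi matrix. For `ν = μ` its roots `x`, `y` satisfy `x + y = ωμ` and `xy = ω - 1`, so
eliminating `ω` gives `x + y = μ(1 + xy)`. The double root `x₀` in the unit disc minimizes `max ‖x‖
‖y‖` (`norm_le_max_of_add_eq`), and it occurs at `ω_opt = 1 + x₀²`. There each other eigenvalue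
`tμ`, with `t` in `[-1, 1]`, gives roots of the same modulus (`norm_eq_of_sq_add_sq_eq`), so the
spectral radius is exactly `‖x₀‖²`.

Thus the rate depends on `μ` alone, which makes the limit uniform in the matrices. In terms of `p =
√(1 - μ)` it is `Re (rateFun p)`, with `rateFun' 0 = 2√2`. Since `p` may approach the imaginary
axis, an error `o(‖p‖)` is too weak; `isEquivalent_re_rateFun` obtains `o(Re p)`. Finally `Re p =
sin(δ/2) √‖1 - μ‖`. -/

namespace SOR

/-! ### Spectra and Young's relation -/

section Matrices

variable {n : ℕ}

theorem mem_spectrum_iff_det {B : Matrix (Fin n) (Fin n) ℂ} {z : ℂ} :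
    z ∈ spectrum ℂ B ↔ (z • (1 : Matrix (Fin n) (Fin n) ℂ) - B).det = 0 := by
  rw [Matrix.mem_spectrum_iff_isRoot_charpoly, Polynomial.IsRoot.def, Matrix.eval_charpoly,
    Matrix.scalar_apply, Matrix.smul_one_eq_diagonal]

theorem norm_le_rho {B : Matrix (Fin n) (Fin n) ℂ} {z : ℂ} (hz : z ∈ spectrum ℂ B) :
    ‖z‖ ≤ rho B := by
  -- `toReal` sends `⊤` to `0`, so finiteness must be known first.
  have hfin : spectralRadius ℂ B ≠ ⊤ := by
    obtain ⟨w, -, hw⟩ : ∃ w ∈ spectrum ℂ B, ∀ v ∈ spectrum ℂ B, ‖v‖₊ ≤ ‖w‖₊ :=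
      Set.exists_max_image _ _ (Matrix.finite_spectrum B) ⟨z, hz⟩
    refine ne_top_of_le_ne_top (ENNReal.coe_ne_top (r := ‖w‖₊)) ?_
    exact iSup₂_le fun v hv => ENNReal.coe_le_coe.2 (hw v hv)
  have h : (‖z‖₊ : ENNReal) ≤ spectralRadius ℂ B :=
    le_iSup₂ (f := fun k (_ : k ∈ spectrum ℂ B) => (‖k‖₊ : ENNReal)) z hz
  simpa [rho] using ENNReal.toReal_mono hfin h

theorem rho_le {B : Matrix (Fin n) (Fin n) ℂ} {c : ℝ} (hc : 0 ≤ c)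
    (h : ∀ z ∈ spectrum ℂ B, ‖z‖ ≤ c) : rho B ≤ c := by
  refine ENNReal.toReal_le_of_le_ofReal hc (iSup₂_le fun z hz => ?_)
  change ‖z‖ₑ ≤ _
  rw [← ofReal_norm]
  exact ENNReal.ofReal_le_ofReal (h z hz)

theorem IsTwoCyclic.diag_ne_zero {A : Matrix (Fin n) (Fin n) ℂ} (h : IsTwoCyclic A) (i : Fin n) :
    A i i ≠ 0 := by
  obtain ⟨p, q, e, d₁, d₂, A₁₂, A₂₁, h₁, h₂, hA⟩ := h
  have hi : A i i = Matrix.reindex e e A (e i) (e i) := by simp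
  rw [hi, hA]
  rcases e i with j | j
  · simpa using h₁ j
  · simpa using h₂ j

theorem det_diagPart_ne_zero {A : Matrix (Fin n) (Fin n) ℂ} (hA : ∀ i, A i i ≠ 0) :
    (diagPart A).det ≠ 0 := by
  simpa [diagPart, Finset.prod_ne_zero_iff] using hA

theorem det_diagPart_sub_smul_lowerPart (A : Matrix (Fin n) (Fin n) ℂ) (ω : ℂ) :
    (diagPart A - ω • lowerPart A).det = (diagPart A).det := by
  rw [Matrix.det_of_isLowerTriangular]
  · simp [diagPart, lowerPart]
  · intro i j hij
    have hij : i < j := hij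
    simp [diagPart, lowerPart, hij.ne, hij.not_gt]

/-- The pencil `c - k K` is singular iff `c = k ν` for an eigenvalue `ν` of `K`. -/
theorem det_smul_one_sub_smul_eq_zero_iff [NeZero n] (K : Matrix (Fin n) (Fin n) ℂ) (c k : ℂ) :
    (c • (1 : Matrix (Fin n) (Fin n) ℂ) - k • K).det = 0 ↔ ∃ ν ∈ spectrum ℂ K, c = k * ν := by
  rcases eq_or_ne k 0 with rfl | hk
  · have hne : (spectrum ℂ K).Nonempty :=
      spectrum.nonempty_of_isAlgClosed_of_finiteDimensional ℂ K
    obtain ⟨ν, hν⟩ := hne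
    simp only [zero_smul, sub_zero, Matrix.det_smul, Matrix.det_one, mul_one, zero_mul]
    rw [pow_eq_zero_iff (by simpa using NeZero.ne n)]
    exact ⟨fun h => ⟨ν, hν, h⟩, fun ⟨_, _, h⟩ => h⟩
  · have h : c • (1 : Matrix (Fin n) (Fin n) ℂ) - k • K = k • ((c / k) • 1 - K) := by
      rw [smul_sub, smul_smul, mul_div_cancel₀ _ hk]
    rw [h, Matrix.det_smul, mul_eq_zero_iff_left (pow_ne_zero _ hk), ← mem_spectrum_iff_det]
    constructor
    · exact fun hm => ⟨_, hm, by field_simp⟩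
    · rintro ⟨ν, hν, rfl⟩
      rwa [mul_div_cancel_left₀ _ hk]

/-- Young's relation between the eigenvalues of the SOR and Jacobi iteration matrices. -/
theorem sq_mem_spectrum_sorMatrix_iff [NeZero n] {A : Matrix (Fin n) (Fin n) ℂ}
    (hA : ∀ i, A i i ≠ 0) (hord : IsConsistentlyOrdered A) {ω ξ : ℂ} (hξ : ξ ≠ 0) :
    ξ ^ 2 ∈ spectrum ℂ (sorMatrix A ω) ↔
      ∃ ν ∈ spectrum ℂ (jacobiMatrix A), ξ ^ 2 + ω - 1 = ω * ξ * ν := by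
  have hD := det_diagPart_ne_zero hA
  have hDE : IsUnit (diagPart A - ω • lowerPart A).det := by
    rw [det_diagPart_sub_smul_lowerPart]; exact hD.isUnit
  set D := diagPart A with hDdef
  set E := lowerPart A with hEdef
  set F := upperPart A with hFdef
  set K := ξ • (D⁻¹ * E) + ξ⁻¹ • (D⁻¹ * F) with hK
  -- Both sides equal `(ξ² + ω - 1)D - ωξ²E - ωF`. Consistent ordering with `α = ξ` then replaces
  -- `K` by the Jacobi matrix.
  have hprod : (D - ω • E) * (ξ ^ 2 • 1 - sorMatrix A ω) =
      D * ((ξ ^ 2 + ω - 1) • 1 - (ω * ξ) • K) := by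
    have h₁ : (D - ω • E) * sorMatrix A ω = ω • F + (1 - ω) • D := by
      rw [sorMatrix, Matrix.mul_nonsing_inv_cancel_left _ _ hDE]
    have h₂ : D * K = ξ • E + ξ⁻¹ • F := by
      rw [hK, Matrix.mul_add, Matrix.mul_smul, Matrix.mul_smul,
        Matrix.mul_nonsing_inv_cancel_left _ _ hD.isUnit,
        Matrix.mul_nonsing_inv_cancel_left _ _ hD.isUnit]
    rw [Matrix.mul_sub, h₁, Matrix.mul_sub, Matrix.mul_smul D _ K, h₂, Matrix.mul_smul,
      Matrix.mul_smul, mul_one, mul_one]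
    ext i j
    simp only [Matrix.sub_apply, Matrix.smul_apply, Matrix.add_apply, smul_eq_mul]
    field_simp
    ring
  have hspec : spectrum ℂ K = spectrum ℂ (jacobiMatrix A) := by
    ext z
    rw [Matrix.mem_spectrum_iff_isRoot_charpoly, Matrix.mem_spectrum_iff_isRoot_charpoly,
      hord ξ hξ]
  rw [← hspec, ← det_smul_one_sub_smul_eq_zero_iff, mem_spectrum_iff_det]
  have hdet := congrArg Matrix.det hprod
  rw [Matrix.det_mul, Matrix.det_mul] at hdet
  rw [← mul_eq_zero_iff_left hDE.ne_zero, hdet, mul_eq_zero_iff_left hD]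

end Matrices

/-! ### Two facts on quadratics, and square roots -/

/-- If `x₀` is the root of `2 x = μ (1 + x²)` in the open unit disc, then every solution of
`x + y = μ (1 + x y)` has a component of modulus at least `‖x₀‖`. -/
theorem norm_le_max_of_add_eq {μ x₀ x y : ℂ} (h₀ : ‖x₀‖ < 1) (hx₀ : 2 * x₀ = μ * (1 + x₀ ^ 2))
    (hxy : x + y = μ * (1 + x * y)) : ‖x₀‖ ≤ max ‖x‖ ‖y‖ := by
  by_contra! hlt
  obtain ⟨hx, hy⟩ := max_lt_iff.1 hlt
  have hne : ∀ z : ℂ, ‖z‖ < ‖x₀‖ → 1 - x₀ * z ≠ 0 := by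
    intro z hz h
    have : ‖x₀ * z‖ = 1 := by rw [← sub_eq_zero.1 h]; simp
    rw [norm_mul] at this
    nlinarith [norm_nonneg z, norm_nonneg x₀]
  -- The Möbius involution `z ↦ (x₀ - z)/(1 - x₀ z)` turns the relation into `w + w' = 0`.
  have hsum : (x₀ - x) / (1 - x₀ * x) + (x₀ - y) / (1 - x₀ * y) = 0 := by
    have h1 := hne x hx
    have h2 := hne y hy
    have h3 : (1 + x₀ ^ 2) ≠ 0 := by
      intro h
      have h4 : x₀ = 0 := by rw [h] at hx₀; simpa using hx₀
      simp [h4] at h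
    field_simp
    have : μ = 2 * x₀ / (1 + x₀ ^ 2) := by field_simp; linear_combination -hx₀
    rw [this] at hxy
    field_simp at hxy
    linear_combination -hxy
  set w := (x₀ - x) / (1 - x₀ * x) with hw
  -- By involutivity `z = (x₀ - v)/(1 - x₀ v)`, so this is `‖z‖ < ‖x₀‖` with denominators cleared.
  have key : ∀ z v : ℂ, ‖z‖ < ‖x₀‖ → v = (x₀ - z) / (1 - x₀ * z) →
      ‖x₀ - v‖ ^ 2 < ‖x₀‖ ^ 2 * ‖1 - x₀ * v‖ ^ 2 := by
    intro z v hz hv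
    have h1 := hne z hz
    have h2 : x₀ - v = z * (1 - x₀ * v) := by
      rw [hv]; field_simp; ring
    have h3 : 1 - x₀ * v ≠ 0 := by
      have : 1 - x₀ * v = (1 - x₀ ^ 2) / (1 - x₀ * z) := by rw [hv]; field_simp; ring
      rw [this]
      refine div_ne_zero (fun h => ?_) h1
      have : ‖x₀ ^ 2‖ = 1 := by rw [← sub_eq_zero.1 h]; simp
      rw [norm_pow] at this
      nlinarith [norm_nonneg x₀]
    rw [h2, norm_mul, mul_pow]
    have := norm_pos_iff.2 h3
    gcongr
  have k1 := key x w hx hw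
  have k2 := key y (-w) hy (by linear_combination -hsum)
  -- Adding the bounds for `w` and `-w` gives `‖x₀‖² + ‖w‖² < ‖x₀‖² + ‖x₀‖⁴ ‖w‖²`, impossible as
  -- `‖x₀‖ < 1`.
  have p1 := parallelogram_law_with_norm ℝ x₀ w
  have p2 := parallelogram_law_with_norm ℝ 1 (x₀ * w)
  simp only [sub_neg_eq_add, mul_neg, norm_mul, norm_one] at k1 k2 p1 p2
  have h4 : ‖x₀‖ ^ 4 ≤ 1 := pow_le_one₀ (norm_nonneg _) h₀.le
  nlinarith [sq_nonneg ‖w‖, mul_le_mul_of_nonneg_left h4 (sq_nonneg ‖w‖)]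

/-- Reciprocal quadratics with coefficient in `[-2, 2]` have roots of modulus one. -/
theorem norm_eq_of_sq_add_sq_eq {x x₀ : ℂ} {t : ℝ} (ht : |t| ≤ 1)
    (h : x ^ 2 + x₀ ^ 2 = 2 * t * x * x₀) : ‖x‖ = ‖x₀‖ := by
  rcases eq_or_ne x₀ 0 with rfl | hx₀
  · simpa using h
  obtain ⟨u, rfl⟩ : ∃ u, x = u * x₀ := ⟨x / x₀, by field_simp⟩
  -- A nonpositive real square: `u = t ± i√(1 - t²)` lies on the unit circle.
  have hu : (u - t) ^ 2 = ((-(1 - t ^ 2) : ℝ) : ℂ) := by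
    apply mul_right_cancel₀ (pow_ne_zero 2 hx₀)
    push_cast
    linear_combination h
  have hre := congrArg Complex.re hu
  have him := congrArg Complex.im hu
  simp only [pow_two, Complex.mul_re, Complex.mul_im, Complex.sub_re, Complex.sub_im,
    Complex.ofReal_re, Complex.ofReal_im, sub_zero] at hre him
  have ht2 : t * t ≤ 1 := by nlinarith [abs_le.1 ht]
  have hut : u.re = t := by
    have : (u.re - t) * u.im = 0 := by linarith
    rcases mul_eq_zero.1 this with h | h
    · linarith
    · rw [h] at hre
      nlinarith [sq_nonneg (u.re - t)]
  have : ‖u‖ = 1 := by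
    rw [← sq_eq_sq₀ (norm_nonneg _) zero_le_one, Complex.sq_norm, Complex.normSq_apply]
    rw [hut] at hre ⊢
    linarith
  rw [norm_mul, this, one_mul]

theorem cpow_half_sq (z : ℂ) : (z ^ (1 / 2 : ℂ)) ^ 2 = z := by
  rw [one_div]; exact Complex.cpow_ofNat_inv_pow z 2

theorem re_cpow_half_pos {z : ℂ} (hz : z ∈ Complex.slitPlane) : 0 < (z ^ (1 / 2 : ℂ)).re := by
  have h := Complex.mem_slitPlane_iff_arg.1 hz
  have h1 := Complex.neg_pi_lt_arg z
  have h2 := lt_of_le_of_ne (Complex.arg_le_pi z) h.1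
  rw [Complex.cpow_def_of_ne_zero h.2, Complex.exp_re]
  have him : (Complex.log z * (1 / 2)).im = z.arg / 2 := by
    have : Complex.log z * (1 / 2) = Complex.log z / (2 : ℝ) := by push_cast; ring
    rw [this, Complex.div_ofReal_im, Complex.log_im]
  rw [him]
  exact mul_pos (Real.exp_pos _) (Real.cos_pos_of_mem_Ioo ⟨by linarith, by linarith⟩)

theorem eq_of_sq_eq_of_re_pos {z w : ℂ} (h : z ^ 2 = w ^ 2) (hz : 0 < z.re) (hw : 0 < w.re) :
    z = w := by
  rcases sq_eq_sq_iff_eq_or_eq_neg.1 h with h | h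
  · exact h
  · rw [h, Complex.neg_re] at hz
    linarith

/-! ### The slit half-plane and the optimal parameter -/

section Parameter

variable {μ : ℂ}

theorem one_sub_mem_slitPlane (hμ : μ ∈ slitHalfPlane) : 1 - μ ∈ Complex.slitPlane := by
  rw [Complex.mem_slitPlane_iff]
  by_contra! h
  simp only [Complex.sub_re, Complex.one_re, Complex.sub_im, Complex.one_im, zero_sub,
    neg_eq_zero] at h
  exact hμ.2 ⟨by linarith, h.2⟩

theorem one_add_mem_slitPlane (hμ : μ ∈ slitHalfPlane) : 1 + μ ∈ Complex.slitPlane := by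
  have : 0 ≤ μ.re := hμ.1
  refine Complex.mem_slitPlane_iff.2 (Or.inl ?_)
  simp only [Complex.add_re, Complex.one_re]
  linarith

theorem one_sub_sq_mem_slitPlane (hμ : μ ∈ slitHalfPlane) : 1 - μ ^ 2 ∈ Complex.slitPlane := by
  have h0 : 0 ≤ μ.re := hμ.1
  rw [Complex.mem_slitPlane_iff]
  by_contra! h
  simp only [pow_two, Complex.sub_re, Complex.one_re, Complex.sub_im, Complex.one_im,
    Complex.mul_re, Complex.mul_im] at h
  have h1 : μ.re * μ.im = 0 := by linarith
  have h2 : μ.im = 0 := by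
    rcases mul_eq_zero.1 h1 with h3 | h3
    · rw [h3] at h
      nlinarith [h.1, sq_nonneg μ.im]
    · exact h3
  refine hμ.2 ⟨?_, h2⟩
  rw [h2] at h
  nlinarith [h.1]

theorem cpow_half_mul_cpow_half (hμ : μ ∈ slitHalfPlane) :
    (1 - μ) ^ (1 / 2 : ℂ) * (1 + μ) ^ (1 / 2 : ℂ) = (1 - μ ^ 2) ^ (1 / 2 : ℂ) := by
  have hp := re_cpow_half_pos (one_sub_mem_slitPlane hμ)
  have hq := re_cpow_half_pos (one_add_mem_slitPlane hμ)
  have hp2 := cpow_half_sq (1 - μ)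
  have hq2 := cpow_half_sq (1 + μ)
  refine eq_of_sq_eq_of_re_pos ?_ ?_ (re_cpow_half_pos (one_sub_sq_mem_slitPlane hμ))
  · rw [mul_pow, hp2, hq2, cpow_half_sq]; ring
  · generalize (1 - μ) ^ (1 / 2 : ℂ) = p at *
    generalize (1 + μ) ^ (1 / 2 : ℂ) = q at *
    have e1 := congrArg Complex.im hp2
    have e2 := congrArg Complex.im hq2
    simp only [pow_two, Complex.mul_im, Complex.sub_im, Complex.add_im, Complex.one_im] at e1 e2
    rw [Complex.mul_re]
    -- `p²` and `q²` have opposite imaginary parts and `Re p, Re q > 0`, so `Im p · Im q ≤ 0` and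
    -- `Re (pq) > 0`.
    have h1 : p.re * q.re * (p.im * q.im) ≤ 0 := by
      have : (p.re * p.im) * (q.re * q.im) ≤ 0 := by
        have a1 : p.re * p.im = -(μ.im / 2) := by linarith
        have a2 : q.re * q.im = μ.im / 2 := by linarith
        rw [a1, a2]; nlinarith [sq_nonneg (μ.im / 2)]
      linarith
    have h2 : 0 < p.re * q.re := mul_pos hp hq
    have h3 := nonpos_of_mul_nonpos_right h1 h2
    linarith

/-- The root of `2 x = μ (1 + x²)` in the open unit disc. -/
noncomputable def optRoot (μ : ℂ) : ℂ := μ / (1 + (1 - μ ^ 2) ^ (1 / 2 : ℂ))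

theorem norm_one_sub_lt_norm_one_add {s : ℂ} (hs : 0 < s.re) : ‖1 - s‖ < ‖1 + s‖ := by
  rw [← sq_lt_sq₀ (norm_nonneg _) (norm_nonneg _), Complex.sq_norm, Complex.sq_norm,
    Complex.normSq_apply, Complex.normSq_apply]
  simp only [Complex.sub_re, Complex.one_re, Complex.sub_im, Complex.one_im, Complex.add_re,
    Complex.add_im]
  nlinarith

theorem one_add_ne_zero {s : ℂ} (hs : 0 < s.re) : 1 + s ≠ 0 :=
  norm_pos_iff.1 ((norm_nonneg _).trans_lt (norm_one_sub_lt_norm_one_add hs))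

theorem optRoot_sq (hμ : μ ∈ slitHalfPlane) :
    optRoot μ ^ 2 = (1 - (1 - μ ^ 2) ^ (1 / 2 : ℂ)) / (1 + (1 - μ ^ 2) ^ (1 / 2 : ℂ)) := by
  have hs := one_add_ne_zero (re_cpow_half_pos (one_sub_sq_mem_slitPlane hμ))
  have h2 := cpow_half_sq (1 - μ ^ 2)
  rw [optRoot]
  generalize (1 - μ ^ 2) ^ (1 / 2 : ℂ) = s at *
  field_simp
  linear_combination h2

theorem omegaOpt_eq (hμ : μ ∈ slitHalfPlane) : omegaOpt μ = 1 + optRoot μ ^ 2 := by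
  have hs := one_add_ne_zero (re_cpow_half_pos (one_sub_sq_mem_slitPlane hμ))
  rw [optRoot_sq hμ, omegaOpt]
  generalize (1 - μ ^ 2) ^ (1 / 2 : ℂ) = s at *
  field_simp
  ring

theorem two_mul_optRoot (μ : ℂ) : 2 * optRoot μ = μ * omegaOpt μ := by
  rw [optRoot, omegaOpt]
  ring

theorem norm_optRoot_lt_one (hμ : μ ∈ slitHalfPlane) : ‖optRoot μ‖ < 1 := by
  have hs := norm_one_sub_lt_norm_one_add (re_cpow_half_pos (one_sub_sq_mem_slitPlane hμ))
  rw [← pow_lt_one_iff_of_nonneg (norm_nonneg _) two_ne_zero, ← norm_pow, optRoot_sq hμ, norm_div]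
  exact (div_lt_one ((norm_nonneg _).trans_lt hs)).2 hs

/-- Half-angle formula: for `p = √(1 - μ)`, `sin²(δ/2) ‖1 - μ‖ = (‖p‖² + Re p²)/2 = (Re p)²`. -/
theorem sin_phase_mul_sqrt (hμ : μ ∈ slitHalfPlane) :
    Real.sin (phase μ / 2) * √‖1 - μ‖ = ((1 - μ) ^ (1 / 2 : ℂ)).re := by
  have hne : μ - 1 ≠ 0 := by
    have := Complex.slitPlane_ne_zero (one_sub_mem_slitPlane hμ)
    rwa [← neg_sub, neg_ne_zero]
  have hp := re_cpow_half_pos (one_sub_mem_slitPlane hμ)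
  have h2 := cpow_half_sq (1 - μ)
  have hsin : 0 ≤ Real.sin (phase μ / 2) := by
    have h1 := Complex.abs_arg_le_pi (μ - 1)
    have h0 := abs_nonneg (Complex.arg (μ - 1))
    exact Real.sin_nonneg_of_nonneg_of_le_pi (by rw [phase]; linarith) (by rw [phase]; linarith)
  generalize (1 - μ) ^ (1 / 2 : ℂ) = p at *
  rw [← sq_eq_sq₀ (by positivity) hp.le, mul_pow, Real.sq_sqrt (norm_nonneg _),
    Real.sin_sq_eq_half_sub, mul_div_cancel₀ _ two_ne_zero, phase, Real.cos_abs,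
    Complex.cos_arg hne, norm_sub_rev μ 1]
  have hnorm : ‖1 - μ‖ = p.re ^ 2 + p.im ^ 2 := by
    rw [← h2, norm_pow, Complex.sq_norm, Complex.normSq_apply]; ring
  have hpos : ‖1 - μ‖ ≠ 0 := by rw [norm_sub_rev]; exact norm_ne_zero_iff.2 hne
  have hre := congrArg Complex.re h2
  simp only [pow_two, Complex.mul_re, Complex.sub_re, Complex.one_re] at hre
  have : (1 / 2 - (μ - 1).re / ‖1 - μ‖ / 2) * ‖1 - μ‖ = (‖1 - μ‖ - (μ - 1).re) / 2 := by
    field_simp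
  rw [this, hnorm, Complex.sub_re, Complex.one_re]
  linarith

end Parameter

/-! ### The optimal spectral radius -/

section Optimality

variable {n : ℕ} [NeZero n] {A : Matrix (Fin n) (Fin n) ℂ} {μ : ℂ}

theorem norm_optRoot_sq_le_rho (hA : ∀ i, A i i ≠ 0) (hord : IsConsistentlyOrdered A)
    (hpos : μ ∈ spectrum ℂ (jacobiMatrix A)) (hμ : μ ∈ slitHalfPlane) (ω : ℂ) :
    ‖optRoot μ‖ ^ 2 ≤ rho (sorMatrix A ω) := by
  have hmem : ∀ ξ : ℂ, ξ ^ 2 + ω - 1 = ω * ξ * μ → ‖ξ‖ ^ 2 ≤ rho (sorMatrix A ω) := by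
    intro ξ h
    rcases eq_or_ne ξ 0 with rfl | hξ
    · simp [rho]
    · rw [← norm_pow]
      exact norm_le_rho ((sq_mem_spectrum_sorMatrix_iff hA hord hξ).2 ⟨μ, hpos, h⟩)
  -- `d` is a square root of the discriminant of Young's quadratic at `ν = μ`.
  obtain ⟨d, hd⟩ := IsAlgClosed.exists_pow_nat_eq ((ω * μ) ^ 2 - 4 * (ω - 1)) two_pos
  have hx := hmem ((ω * μ + d) / 2) (by linear_combination hd / 4)
  have hy := hmem ((ω * μ - d) / 2) (by linear_combination hd / 4)
  have h := norm_le_max_of_add_eq (μ := μ) (x := (ω * μ + d) / 2) (y := (ω * μ - d) / 2)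
    (norm_optRoot_lt_one hμ)
    (by rw [← omegaOpt_eq hμ, two_mul_optRoot μ]) (by linear_combination μ / 4 * hd)
  rcases le_max_iff.1 h with h | h
  · exact (pow_le_pow_left₀ (norm_nonneg _) h 2).trans hx
  · exact (pow_le_pow_left₀ (norm_nonneg _) h 2).trans hy

theorem exists_real_of_mem_segment_neg {z ν : ℂ} (h : ν ∈ segment ℝ (-z) z) :
    ∃ t : ℝ, |t| ≤ 1 ∧ ν = t * z := by
  obtain ⟨a, b, ha, hb, hab, rfl⟩ := h
  refine ⟨b - a, abs_le.2 ⟨by linarith, by linarith⟩, ?_⟩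
  simp only [Complex.real_smul]
  push_cast
  ring

theorem rho_sorMatrix_omegaOpt_le (hA : ∀ i, A i i ≠ 0) (hord : IsConsistentlyOrdered A)
    (hseg : spectrum ℂ (jacobiMatrix A) ⊆ segment ℝ (-μ) μ) (hμ : μ ∈ slitHalfPlane) :
    rho (sorMatrix A (omegaOpt μ)) ≤ ‖optRoot μ‖ ^ 2 := by
  refine rho_le (by positivity) fun z hz => ?_
  obtain ⟨ξ, rfl⟩ := IsAlgClosed.exists_pow_nat_eq z two_pos
  rcases eq_or_ne ξ 0 with rfl | hξ
  · simp
  obtain ⟨ν, hν, h⟩ := (sq_mem_spectrum_sorMatrix_iff hA hord hξ).1 hz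
  obtain ⟨t, ht, rfl⟩ := exists_real_of_mem_segment_neg (hseg hν)
  have h1 := omegaOpt_eq hμ
  have h2 := two_mul_optRoot μ
  rw [norm_pow, norm_eq_of_sq_add_sq_eq ht (x₀ := optRoot μ)]
  linear_combination h - h1 - t * ξ * h2

theorem rho_sorMatrix_omegaOpt (hA : ∀ i, A i i ≠ 0) (hord : IsConsistentlyOrdered A)
    (hseg : spectrum ℂ (jacobiMatrix A) ⊆ segment ℝ (-μ) μ)
    (hpos : μ ∈ spectrum ℂ (jacobiMatrix A)) (hμ : μ ∈ slitHalfPlane) :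
    rho (sorMatrix A (omegaOpt μ)) = ‖optRoot μ‖ ^ 2 :=
  (rho_sorMatrix_omegaOpt_le hA hord hseg hμ).antisymm
    (norm_optRoot_sq_le_rho hA hord hpos hμ _)

theorem rho_jacobiMatrix {n : ℕ} {A : Matrix (Fin n) (Fin n) ℂ}
    (hseg : spectrum ℂ (jacobiMatrix A) ⊆ segment ℝ (-μ) μ)
    (hpos : μ ∈ spectrum ℂ (jacobiMatrix A)) : rho (jacobiMatrix A) = ‖μ‖ := by
  refine (rho_le (norm_nonneg _) fun z hz => ?_).antisymm (norm_le_rho hpos)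
  obtain ⟨t, ht, rfl⟩ := exists_real_of_mem_segment_neg (hseg hz)
  rw [norm_mul, Complex.norm_real, Real.norm_eq_abs]
  exact mul_le_of_le_one_left (norm_nonneg _) ht

end Optimality

/-! ### Asymptotics of the rate -/

section Asymptotics

/-- `-log ((1 - s) / (1 + s))` with `s = √(1 - μ²)`, as a function of `p = √(1 - μ)`. -/
noncomputable def rateFun (p : ℂ) : ℂ :=
  Complex.log (1 + p * (2 - p ^ 2) ^ (1 / 2 : ℂ)) - Complex.log (1 - p * (2 - p ^ 2) ^ (1 / 2 : ℂ))

theorem re_rateFun (p : ℂ) : (rateFun p).re =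
    Real.log ‖1 + p * (2 - p ^ 2) ^ (1 / 2 : ℂ)‖ -
      Real.log ‖1 - p * (2 - p ^ 2) ^ (1 / 2 : ℂ)‖ := by
  rw [rateFun, Complex.sub_re, Complex.log_re, Complex.log_re]

theorem ofReal_cpow_half {x : ℝ} (hx : 0 ≤ x) : (x : ℂ) ^ (1 / 2 : ℂ) = (√x : ℝ) := by
  rw [Real.sqrt_eq_rpow, Complex.ofReal_cpow hx]
  norm_num

/-- For imaginary `p` the root `√(2 - p²)` is real, so the arguments of the two logarithms are
conjugate. -/
theorem re_rateFun_mul_I (b : ℝ) : (rateFun (b * Complex.I)).re = 0 := by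
  have h : (2 : ℂ) - (b * Complex.I) ^ 2 = ((2 + b ^ 2 : ℝ) : ℂ) := by
    rw [mul_pow, Complex.I_sq]; push_cast; ring
  rw [re_rateFun, h, ofReal_cpow_half (by positivity), sub_eq_zero]
  congr 1
  rw [← Complex.norm_conj]
  congr 1
  simp
  ring

theorem hasStrictDerivAt_rateFun : HasStrictDerivAt rateFun ((2 * √2 : ℝ) : ℂ) 0 := by
  have h1 : HasStrictDerivAt (fun p : ℂ => 2 - p ^ 2) 0 0 := by
    simpa using ((hasStrictDerivAt_id (0 : ℂ)).pow 2).const_sub 2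
  have h2 := h1.cpow_const (c := 1 / 2) (by norm_num [Complex.mem_slitPlane_iff])
  have h3 := (hasStrictDerivAt_id (0 : ℂ)).mul h2
  have h4 := (h3.const_add 1).clog (by simp)
  have h5 := (h3.const_sub 1).clog (by simp)
  have h6 : (2 : ℂ) ^ (1 / 2 : ℂ) = (√2 : ℝ) := by
    rw [← ofReal_cpow_half zero_le_two]; norm_num
  refine (h4.sub h5).congr_deriv ?_
  simp only [id, Pi.mul_apply, zero_mul, add_zero, sub_zero, mul_zero, div_one, one_mul,
    zero_pow two_ne_zero, h6]
  push_cast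
  ring

/-- Strict differentiability compares `p` with `i Im p`, where `Re rateFun` vanishes; the error is
then small relative to `‖p - i Im p‖ = |Re p|`. -/
theorem isEquivalent_re_rateFun :
    Asymptotics.IsEquivalent (𝓝 0) (fun p => (rateFun p).re) (fun p => 2 * √2 * p.re) := by
  have h := hasStrictDerivAt_rateFun.isLittleO
  have ht : Tendsto (fun p : ℂ => (p, (p.im : ℂ) * Complex.I)) (𝓝 0) (𝓝 (0, 0)) := by
    have : Continuous (fun p : ℂ => (p, (p.im : ℂ) * Complex.I)) := by fun_prop
    simpa using this.tendsto 0
  have h' := h.comp_tendsto ht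
  have hsub : ∀ p : ℂ, p - p.im * Complex.I = p.re := fun p => by
    nth_rw 1 [← Complex.re_add_im p]; ring
  have h'' : (fun p : ℂ => (rateFun p).re - 2 * √2 * p.re) =o[𝓝 0] fun p : ℂ => p.re := by
    refine Asymptotics.IsBigO.trans_isLittleO (Asymptotics.isBigO_of_le _ fun p => ?_)
      (h'.trans_isBigO (Asymptotics.isBigO_of_le _ fun p => ?_))
    · refine le_trans (le_of_eq ?_) (Complex.abs_re_le_norm _)
      simp [hsub, re_rateFun_mul_I, Real.norm_eq_abs]
      ring_nf
    · simp [hsub]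
  exact h''.trans_isBigO
    (Asymptotics.isBigO_self_const_mul (by positivity) _ _)

end Asymptotics

/-- At `μ = 0` the radius is `0`, and the convention `Real.log 0 = 0` breaks the formula. -/
theorem asymptoticRate_sorMatrix {n : ℕ} [NeZero n] {A : Matrix (Fin n) (Fin n) ℂ} {μ : ℂ}
    (hA : ∀ i, A i i ≠ 0) (hord : IsConsistentlyOrdered A)
    (hseg : spectrum ℂ (jacobiMatrix A) ⊆ segment ℝ (-μ) μ)
    (hpos : μ ∈ spectrum ℂ (jacobiMatrix A)) (hμ : μ ∈ slitHalfPlane) (hμ0 : μ ≠ 0) :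
    asymptoticRate (sorMatrix A (omegaOpt μ)) = (rateFun ((1 - μ) ^ (1 / 2 : ℂ))).re := by
  have hs := one_add_ne_zero (re_cpow_half_pos (one_sub_sq_mem_slitPlane hμ))
  have hx : optRoot μ ≠ 0 := div_ne_zero hμ0 hs
  have hx2 := optRoot_sq hμ
  have hs' : 1 - (1 - μ ^ 2) ^ (1 / 2 : ℂ) ≠ 0 := fun h => by
    rw [h, zero_div] at hx2
    exact hx (by simpa using hx2)
  rw [asymptoticRate, rho_sorMatrix_omegaOpt hA hord hseg hpos hμ, ← norm_pow, hx2, re_rateFun,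
    cpow_half_sq, show 2 - (1 - μ) = 1 + μ by ring, cpow_half_mul_cpow_half hμ, norm_div,
    Real.log_div (norm_ne_zero_iff.2 hs') (norm_ne_zero_iff.2 hs), neg_sub]

theorem tendsto_neg_log_div_one_sub {ι : Type*} {l : Filter ι} {x : ι → ℝ} (hx : ∀ i, x i < 1)
    (hlim : Tendsto x l (𝓝 1)) : Tendsto (fun i => -Real.log (x i) / (1 - x i)) l (𝓝 1) := by
  have h := (hasDerivAt_iff_tendsto_slope.1 (Real.hasDerivAt_log one_ne_zero)).comp
    (tendsto_nhdsWithin_iff.2 ⟨hlim, Eventually.of_forall fun i => (hx i).ne⟩)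
  simp only [inv_one] at h
  refine h.congr fun i => ?_
  have h1 : x i - 1 ≠ 0 := (sub_neg.2 (hx i)).ne
  have h2 : 1 - x i ≠ 0 := (sub_pos.2 (hx i)).ne'
  simp only [Function.comp, slope_def_field, Real.log_one]
  field_simp
  ring

end SOR

/-! ### The main theorem -/

theorem corollary2p4 {ι : Type*} (l : Filter ι) (n : ι → ℕ)
    (A : ∀ i, Matrix (Fin (n i)) (Fin (n i)) ℂ) (μ : ι → ℂ)
    (hcyc : ∀ i, SOR.IsTwoCyclic (A i))
    (hord : ∀ i, SOR.IsConsistentlyOrdered (A i))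
    (hseg : ∀ i, spectrum ℂ (SOR.jacobiMatrix (A i)) ⊆ segment ℝ (-μ i) (μ i))
    (hpos : ∀ i, μ i ∈ spectrum ℂ (SOR.jacobiMatrix (A i)))
    (hneg : ∀ i, -μ i ∈ spectrum ℂ (SOR.jacobiMatrix (A i)))
    (hμ : ∀ i, μ i ∈ SOR.slitHalfPlane)
    (hlim : Tendsto μ l (𝓝 1)) :
    (∀ i, SOR.IsOptimalRelaxation (A i) (SOR.omegaOpt (μ i))) ∧
    Tendsto (fun i => SOR.asymptoticRate (SOR.sorMatrix (A i) (SOR.omegaOpt (μ i))) /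
      (2 * √2 * Real.sin (SOR.phase (μ i) / 2) * √‖1 - μ i‖)) l (𝓝 1) ∧
    ((∀ i, (μ i).im = 0) →
      Tendsto (fun i => SOR.asymptoticRate (SOR.sorMatrix (A i) (SOR.omegaOpt (μ i))) /
        (2 * √2 * √(SOR.asymptoticRate (SOR.jacobiMatrix (A i))))) l (𝓝 1)) := by
  have hn : ∀ i, NeZero (n i) := fun i => ⟨fun h0 => by
    have : IsEmpty (Fin (n i)) := by rw [h0]; infer_instance
    have h := SOR.mem_spectrum_iff_det.1 (hpos i)
    rw [Matrix.det_isEmpty] at h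
    exact one_ne_zero h⟩
  have hA := fun i => (hcyc i).diag_ne_zero
  have hp : Tendsto (fun i => (1 - μ i) ^ (1 / 2 : ℂ)) l (𝓝 0) := by
    have h : Tendsto (fun i => √‖1 - μ i‖) l (𝓝 0) := by
      simpa using ((hlim.const_sub 1).norm).sqrt
    refine tendsto_zero_iff_norm_tendsto_zero.2 (h.congr fun i => ?_)
    rw [← SOR.cpow_half_sq (1 - μ i), norm_pow, Real.sqrt_sq (norm_nonneg _), SOR.cpow_half_sq]
  have hmain : Tendsto (fun i => SOR.asymptoticRate (SOR.sorMatrix (A i) (SOR.omegaOpt (μ i))) /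
      (2 * √2 * ((1 - μ i) ^ (1 / 2 : ℂ)).re)) l (𝓝 1) := by
    have h := SOR.isEquivalent_re_rateFun.comp_tendsto hp
    have h1 := (Asymptotics.isEquivalent_iff_tendsto_one (Eventually.of_forall fun i =>
      (mul_pos (by positivity : 0 < 2 * √2)
        (SOR.re_cpow_half_pos (SOR.one_sub_mem_slitPlane (hμ i)))).ne')).1 h
    refine h1.congr' ?_
    filter_upwards [hlim.eventually_ne one_ne_zero] with i hi
    rw [SOR.asymptoticRate_sorMatrix (hA i) (hord i) (hseg i) (hpos i) (hμ i) hi]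
    rfl
  refine ⟨fun i ω => ?_, ?_, fun hre => ?_⟩
  · rw [SOR.rho_sorMatrix_omegaOpt (hA i) (hord i) (hseg i) (hpos i) (hμ i)]
    exact SOR.norm_optRoot_sq_le_rho (hA i) (hord i) (hpos i) (hμ i) ω
  · simpa only [mul_assoc, SOR.sin_phase_mul_sqrt (hμ _)] using hmain
  · obtain ⟨x, rfl⟩ : ∃ x : ι → ℝ, μ = fun i => (x i : ℂ) :=
      ⟨fun i => (μ i).re, funext fun i => Complex.ext rfl (hre i)⟩
    have hx0 : ∀ i, 0 ≤ x i := fun i => (hμ i).1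
    have hx1 : ∀ i, x i < 1 := fun i => by
      by_contra! h
      exact (hμ i).2 ⟨h, hre i⟩
    have hxlim : Tendsto x l (𝓝 1) := by
      exact (Complex.continuous_re.tendsto 1).comp hlim
    -- This factor exchanges `√(1 - x)` for `√(-log x)` in the denominator.
    have hsq := ((SOR.tendsto_neg_log_div_one_sub hx1 hxlim).sqrt).inv₀ (by simp)
    have h := hmain.mul hsq
    simp only [Real.sqrt_one, inv_one, mul_one] at h
    refine h.congr fun i => ?_
    have hpos1 : 0 < √(1 - x i) := Real.sqrt_pos.2 (sub_pos.2 (hx1 i))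
    have hp1 : ((1 - (x i : ℂ)) ^ (1 / 2 : ℂ)).re = √(1 - x i) := by
      rw [show (1 : ℂ) - x i = ((1 - x i : ℝ) : ℂ) by push_cast; rfl,
        SOR.ofReal_cpow_half (sub_pos.2 (hx1 i)).le, Complex.ofReal_re]
    have hJ : SOR.asymptoticRate (SOR.jacobiMatrix (A i)) = -Real.log (x i) := by
      rw [SOR.asymptoticRate, SOR.rho_jacobiMatrix (hseg i) (hpos i), Complex.norm_real,
        Real.norm_of_nonneg (hx0 i)]
    rw [hp1, hJ, Real.sqrt_div' _ (sub_pos.2 (hx1 i)).le, inv_div]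
    field_simp
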